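/- Let $W$ be a closed oriented $3$-manifold and $L\subset W$ a non-empty link. A distinguished triangulation $(T,H)$ of $(W,L)$ is a (possibly singular) triangulation $T$ of $W$ by oriented abstract tetrahedra glued along faces, with a subcomplex $H$ of its $1$-skeleton which contains all vertices of $T$ and realizes $L$. Let $\epsilon_T$ be the identification map from the edges of the abstract tetrahedra onto the edges of $T$. An integral charge on $(T,H)$ is an integer function $c$ on the edges of the abstract tetrahedra such that: in each abstract tetrahedron opposite edges have the same charge and the three edges of each face have charges of sum $1$; $\sum_{e'\in\epsilon_T^{-1}(e)}c(e')$ equals $2$ for each edge $e\notin H$ and $0$ for each edge $e\in H$; and for each closed curve in general position without back-tracking, the sum of the charges of the edges that it selects (in each tetrahedron that it traverses, the common edge of the entering and departing faces) is even. Order the vertices $v_0,\dots,v_3$ of each abstract tetrahedron $\Delta$, and let $e_0=[v_0,v_1]$, $e_1=[v_1,v_2]$, $e_2=[v_0,v_2]$. Write a charge as the vector of its coordinates $w_1^{\Delta}=c(e_0)$, $w_2^{\Delta}=-c(e_1)$ (so that $c(e_2)=1-w_1^\Delta+w_2^\Delta$). For an edge $e$ of $T$ let $r_i^{\Delta}(e)$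 be the sum of the coefficients of $w_i^{\Delta}$ in the charges of the edges of $\Delta$ in $\epsilon_T^{-1}(e)$. Neumann's vector $w(e)$ has the coordinates $(r_2^\Delta(e),-r_1^\Delta(e))$ on each $\Delta$ whose vertex order is positive for the orientation, and the opposite ones on the other $\Delta$. Let $(T_1,H_1)\to(T_2,H_2)$ be a $2\to3$ move between distinguished triangulations of $(W,L)$: with the vertices of a bipyramid numbered $0,\dots,4$, two tetrahedra $\Delta^1,\Delta^3$ of $T_1$ with common face $024$ are replaced by three tetrahedra $\Delta^0,\Delta^2,\Delta^4$ around a new edge $e=13$ (where $\Delta^k$ has all the vertices but $k$), and $H_2=H_1$. A charge $c_1$ of $T_1$ transits to $c_2$ of $T_2$ if they agree on the tetrahedra not involved in the move, and if for each of the nine edges $ij\neq 13$ of the bipyramid the sums of $c_1$ and of $c_2$ at $ij$, over the tetrahedra filling the bipyramid, are equal. Let $c_1$, $c_2$ be integral charges on $(T_1,H_1)$, $(T_2,H_2)$ such that $c_1$ transits to $c_2$. Then, as vectors, the integral charges $c_2'$ on $(T_2,H_2)$ to which $c_1$ transits are exactly the elements of $$C(e,c_2,T_2)=\{c_2+\lambda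 w(e):\lambda\in\mathbb Z\}.$$ Moreover $w(e)$ vanishes on the tetrahedra other than $\Delta^0,\Delta^2,\Delta^4$, and if the vertices of these are ordered by their numbers and this order is positive, then $w(e)=(1,-1,1,1,0,1)^t$ in the coordinates $(w_1^{\Delta^0},w_1^{\Delta^2},w_1^{\Delta^4},w_2^{\Delta^0},w_2^{\Delta^2},w_2^{\Delta^4})$. -/

import Mathlib

/-- The edges of the standard tetrahedron with vertex set `Fin 4`: the two-element sets of vertices.
The 2-face opposite to the vertex `f` is also denoted by `f`; it contains the edge `s` iff
`f ∉ s`. -/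
abbrev TetEdge : Type := {s : Finset (Fin 4) // s.card = 2}

/-- The edge joining two distinct vertices. -/
def TetEdge.mk (i j : Fin 4) (h : i ≠ j) : TetEdge :=
  ⟨{i, j}, Finset.card_pair h⟩

/-- The common edge of the two distinct 2-faces opposite to the vertices `f` and `g`. -/
def TetEdge.between (f g : Fin 4) (h : f ≠ g) : TetEdge :=
  ⟨{f, g}ᶜ, by rw [Finset.card_compl, Finset.card_pair h]; rfl⟩

/-- A (singular) triangulation without boundary, with oriented abstract tetrahedra indexed by `τ`.
The face `f` of the tetrahedron `t` is glued to the face `perm t f f` of the tetrahedron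
`adj t f`, by the affine map which sends the vertex `i ≠ f` to the vertex `perm t f i`. The sign
`orient t` compares the orientation of `t` with the one given by the order of its vertices; the
gluings reverse the induced orientations of the faces. -/
structure OrientedTriangulation (τ : Type*) where
  adj : τ → Fin 4 → τ
  perm : τ → Fin 4 → Equiv.Perm (Fin 4)
  adj_adj : ∀ t f, adj (adj t f) (perm t f f) = t
  perm_perm : ∀ t f, perm (adj t f) (perm t f f) = (perm t f)⁻¹
  no_self_glue : ∀ t f, ¬ (adj t f = t ∧ perm t f f = f)
  orient : τ → ℤˣ
  orient_adj : ∀ t f, orient (adj t f) = -(Equiv.Perm.sign (perm t f) * orient t)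

namespace OrientedTriangulation

variable {τ : Type*} (T : OrientedTriangulation τ)

/-- The gluing of the vertex `x` of the face `f` of the tetrahedron `t`. -/
def glue (p : τ × Fin 4 × Fin 4) : τ × Fin 4 × Fin 4 :=
  (T.adj p.1 p.2.1, T.perm p.1 p.2.1 p.2.1, T.perm p.1 p.2.1 p.2.2)

/-- Two edges of abstract tetrahedra are matched by the gluing of a face. -/
def EdgeRel (a b : τ × TetEdge) : Prop :=
  ∃ f : Fin 4, f ∉ a.2.1 ∧ b.1 = T.adj a.1 f ∧ b.2.1 = a.2.1.map (T.perm a.1 f).toEmbedding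

/-- The set `E(T)` of edges of the triangulation. -/
def Edge : Type _ := Quot T.EdgeRel

/-- The identification map from the edges of the abstract tetrahedra to the edges of `T`. -/
def edgeOf (a : τ × TetEdge) : T.Edge := Quot.mk _ a

/-- Two points of abstract tetrahedra (in barycentric coordinates) are matched by the gluing of a
face. -/
def PointRel (p q : Σ _ : τ, stdSimplex ℝ (Fin 4)) : Prop :=
  ∃ f : Fin 4, p.2.1 f = 0 ∧ q.1 = T.adj p.1 f ∧ ∀ i, q.2.1 (T.perm p.1 f i) = p.2.1 i

/-- The polyhedron of `T`: the quotient of the disjoint union of the tetrahedra. -/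
def Space : Type _ := Quot T.PointRel

instance : TopologicalSpace T.Space :=
  inferInstanceAs (TopologicalSpace (Quot T.PointRel))

/-- The union in `T.Space` of a set of edges. -/
def edgeSpace (H : Set T.Edge) : Set T.Space :=
  {y | ∃ (t : τ) (s : TetEdge) (x : stdSimplex ℝ (Fin 4)),
    T.edgeOf (t, s) ∈ H ∧ (∀ i, i ∉ s.1 → x.1 i = 0) ∧ y = Quot.mk _ ⟨t, x⟩}

/-- `(T, H)` is a distinguished triangulation of `(W, L)`: `T` is a triangulation of `W`, and the
subcomplex of the 1-skeleton formed by the edges in `H` contains all the vertices of `T` and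
realizes `L`. -/
def IsDistinguished (H : Set T.Edge) (W : Type*) [TopologicalSpace W] (L : Set W) : Prop :=
  (∃ h : T.Space ≃ₜ W, h '' T.edgeSpace H = L) ∧
  ∀ (t : τ) (i : Fin 4) (x : stdSimplex ℝ (Fin 4)), x.1 i = 1 →
    (Quot.mk _ ⟨t, x⟩ : T.Space) ∈ T.edgeSpace H

/-- A closed curve in general position with respect to `T` and without back-tracking, recorded by
the cyclic sequence of the tetrahedra that it traverses (addition in `Fin (len + 1)` is cyclic)
and of the faces by which it enters and leaves them. -/
structure Curve where
  len : ℕ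
  tet : Fin (len + 1) → τ
  enter : Fin (len + 1) → Fin 4
  leave : Fin (len + 1) → Fin 4
  enter_ne_leave : ∀ i, enter i ≠ leave i
  adj_leave : ∀ i, T.adj (tet i) (leave i) = tet (i + 1)
  perm_leave : ∀ i, T.perm (tet i) (leave i) (leave i) = enter (i + 1)

/-- The sum of the values of `c` on the edges selected by a curve. -/
def Curve.charge {T : OrientedTriangulation τ} (γ : T.Curve) (c : τ × TetEdge → ℤ) : ℤ :=
  ∑ i, c (γ.tet i, TetEdge.between (γ.enter i) (γ.leave i) (γ.enter_ne_leave i))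

end OrientedTriangulation

/-- An integral charge on one tetrahedron: opposite edges have the same charge, and the charges of
the three edges of each face add up to 1. -/
def IsTetCharge (c : TetEdge → ℤ) : Prop :=
  (∀ s s' : TetEdge, s'.1 = s.1ᶜ → c s' = c s) ∧
  ∀ f : Fin 4, ∑ s : TetEdge with f ∉ s.1, c s = 1

namespace OrientedTriangulation

variable {τ : Type*} [Fintype τ] (T : OrientedTriangulation τ)

open Classical in
/-- The sum of the charges around an edge of `T`. -/
noncomputable def edgeSum (c : τ × TetEdge → ℤ) (e : T.Edge) : ℤ :=
  ∑ a : τ × TetEdge with T.edgeOf a = e, c a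

/-- Integral charges on `(T, H)`. -/
structure IsIntegralCharge (H : Set T.Edge) (c : τ × TetEdge → ℤ) : Prop where
  tet : ∀ t, IsTetCharge fun s => c (t, s)
  edge_notMem : ∀ e, e ∉ H → T.edgeSum c e = 2
  edge_mem : ∀ e, e ∈ H → T.edgeSum c e = 0
  curve : ∀ γ : T.Curve, Even (γ.charge c)

end OrientedTriangulation

/-- The coordinates `(w₁, w₂)` of a charge: on each tetrahedron `w₁ = c(e₀)` and `w₂ = -c(e₁)`,
where `e₀ = [v₀, v₁]` and `e₁ = [v₁, v₂]`. -/
def chargeVector {τ : Type*} (c : τ × TetEdge → ℤ) : τ ⊕ τ → ℤ :=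
  Sum.elim (fun t => c (t, TetEdge.mk 0 1 (by decide)))
    (fun t => -c (t, TetEdge.mk 1 2 (by decide)))

/-- The coefficient of `w₁` in the charge of an edge of a tetrahedron. The edges `e₀` and its
opposite have charge `w₁`, the edge `e₁` and its opposite have charge `-w₂`, and the edge
`e₂ = [v₀, v₂]` and its opposite have charge `1 - w₁ + w₂`. -/
def coeffOne (s : TetEdge) : ℤ :=
  if s.1 = {0, 1} ∨ s.1 = {2, 3} then 1 else if s.1 = {1, 2} ∨ s.1 = {0, 3} then 0 else -1

/-- The coefficient of `w₂` in the charge of an edge of a tetrahedron. -/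
def coeffTwo (s : TetEdge) : ℤ :=
  if s.1 = {0, 1} ∨ s.1 = {2, 3} then 0 else if s.1 = {1, 2} ∨ s.1 = {0, 3} then -1 else 1

namespace OrientedTriangulation

variable {τ : Type*} (T : OrientedTriangulation τ)

open Classical in
/-- The number of occurrences of `w₁` of the tetrahedron `t` around the edge `e`. -/
noncomputable def occOne (e : T.Edge) (t : τ) : ℤ :=
  ∑ s : TetEdge with T.edgeOf (t, s) = e, coeffOne s

open Classical in
/-- The number of occurrences of `w₂` of the tetrahedron `t` around the edge `e`. -/
noncomputable def occTwo (e : T.Edge) (t : τ) : ℤ :=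
  ∑ s : TetEdge with T.edgeOf (t, s) = e, coeffTwo s

/-- Neumann's vector `w(e) = (r₂, -r₁)`. The sign `orient t` is 1 on the tetrahedra whose
vertices are ordered in accordance with the orientation; it makes the vector, as a variation of
charges, independent of the orders of the vertices. -/
noncomputable def neumannVector (e : T.Edge) : τ ⊕ τ → ℤ :=
  Sum.elim (fun t => (T.orient t : ℤ) * T.occTwo e t)
    (fun t => -((T.orient t : ℤ) * T.occOne e t))

end OrientedTriangulation

/-- In a triangulation `T`, tetrahedra `Δᵏ`, `k ∈ K`, on the vertices of a polyhedron with vertex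
set `Fin 5`: the vertices of `Δᵏ` are all the vertices except `k`, and `Δᵏ` and `Δˡ` are glued
along their common face. For `K = {1, 3}` and `K = {0, 2, 4}` these are the two ways of filling the
bipyramid with apexes 1 and 3 over the triangle 0, 2, 4. -/
structure Filling {τ : Type*} (T : OrientedTriangulation τ) (K : Finset (Fin 5)) where
  tet : K → τ
  tet_injective : Function.Injective tet
  vert : K → Fin 4 ↪ Fin 5
  vert_ne : ∀ k i, vert k i ≠ k
  adj_eq : ∀ (k l : K) (f : Fin 4), vert k f = l → T.adj (tet k) f = tet l
  perm_eq : ∀ (k l : K) (f : Fin 4), vert k f = l →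
    ∀ i, i ≠ f → vert l (T.perm (tet k) f i) = vert k i

namespace Filling

variable {τ : Type*} {T : OrientedTriangulation τ} {K : Finset (Fin 5)} (F : Filling T K)

/-- The sum of the charges of the tetrahedra `Δᵏ` on the edge `E` of the polyhedron. -/
def localSum (c : τ × TetEdge → ℤ) (E : Finset (Fin 5)) : ℤ :=
  ∑ k : K, ∑ s : TetEdge with s.1.map (F.vert k) = E, c (F.tet k, s)

end Filling

/-- The correspondence between the vertices of the faces (tetrahedron, face, vertex) which persist
in a replacement of `Δ¹, Δ³` by `Δ⁰, Δ², Δ⁴`: the faces of the other tetrahedra, and the six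
boundary faces of the bipyramid; the one which misses the vertices `q ∈ {1, 3}` and
`m ∈ {0, 2, 4}` is the face of `Δ^q` opposite to `m` and the face of `Δᵐ` opposite to `q`. -/
inductive CornerRel {τ₁ τ₂ : Type*} {T₁ : OrientedTriangulation τ₁}
    {T₂ : OrientedTriangulation τ₂} (F₁ : Filling T₁ {1, 3}) (F₂ : Filling T₂ {0, 2, 4})
    (R : {t // t ∉ Set.range F₁.tet} ≃ {t // t ∉ Set.range F₂.tet}) :
    τ₁ × Fin 4 × Fin 4 → τ₂ × Fin 4 × Fin 4 → Prop
  | outside (t : {t // t ∉ Set.range F₁.tet}) (f x : Fin 4) (hx : x ≠ f) :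
      CornerRel F₁ F₂ R (t.1, f, x) ((R t).1, f, x)
  | boundary (q : ({1, 3} : Finset (Fin 5))) (m : ({0, 2, 4} : Finset (Fin 5)))
      (f f' x x' : Fin 4) (hf : F₁.vert q f = m) (hf' : F₂.vert m f' = q) (hx : x ≠ f)
      (hxx' : F₁.vert q x = F₂.vert m x') :
      CornerRel F₁ F₂ R (F₁.tet q, f, x) (F₂.tet m, f', x')

/-- A `2 → 3` move from `T₁` to `T₂`: two distinct tetrahedra with a common face are replaced by
three tetrahedra around a new edge, and all the other gluings are kept. -/
structure TwoThreeMove {τ₁ τ₂ : Type*} (T₁ : OrientedTriangulation τ₁)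
    (T₂ : OrientedTriangulation τ₂) where
  old : Filling T₁ {1, 3}
  new : Filling T₂ {0, 2, 4}
  rest : {t // t ∉ Set.range old.tet} ≃ {t // t ∉ Set.range new.tet}
  glue_rel : ∀ p p', CornerRel old new rest p p' → CornerRel old new rest (T₁.glue p) (T₂.glue p')

namespace TwoThreeMove

variable {τ₁ τ₂ : Type*} {T₁ : OrientedTriangulation τ₁} {T₂ : OrientedTriangulation τ₂}
  (m : TwoThreeMove T₁ T₂)

/-- `e` is the edge that appears, which joins the vertices 1 and 3. -/
def IsNewEdge (e : T₂.Edge) : Prop :=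
  ∃ (k : ({0, 2, 4} : Finset (Fin 5))) (s : TetEdge),
    s.1.map (m.new.vert k) = {1, 3} ∧ T₂.edgeOf (m.new.tet k, s) = e

/-- The move is a distinguished move `(T₁, H₁) → (T₂, H₂)`: `H₂` consists of the same edges as
`H₁`. -/
structure IsDistinguishedMove (H₁ : Set T₁.Edge) (H₂ : Set T₂.Edge) : Prop where
  outside : ∀ t s, T₁.edgeOf (t.1, s) ∈ H₁ ↔ T₂.edgeOf ((m.rest t).1, s) ∈ H₂
  inside : ∀ q s k s', s.1.map (m.old.vert q) = s'.1.map (m.new.vert k) →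
    (T₁.edgeOf (m.old.tet q, s) ∈ H₁ ↔ T₂.edgeOf (m.new.tet k, s') ∈ H₂)
  new_notMem : ∀ e, m.IsNewEdge e → e ∉ H₂

/-- `c₁` transits to `c₂`: the charges of the tetrahedra which are not involved in the move are the
same, and at each of the nine common edges of the two fillings of the bipyramid the sums of the
charges are equal. -/
structure IsChargeTransit (c₁ : τ₁ × TetEdge → ℤ) (c₂ : τ₂ × TetEdge → ℤ) : Prop where
  outside : ∀ t s, c₂ ((m.rest t).1, s) = c₁ (t.1, s)
  inside : ∀ E : Finset (Fin 5), E.card = 2 → E ≠ {1, 3} →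
    m.old.localSum c₁ E = m.new.localSum c₂ E

end TwoThreeMove

/-- A non-empty link: a non-empty finite disjoint union of embedded circles. -/
def IsLink {W : Type*} [TopologicalSpace W] (L : Set W) : Prop :=
  ∃ (n : ℕ) (g : Fin n × Circle → W), 0 < n ∧ Topology.IsEmbedding g ∧ Set.range g = L

/-! Adding Neumann's vector changes the charge of an abstract edge `s` of `t` by `orient t` times
the sum of `edgePairing s r` over the edges `r` of `t` that lie above `e` (`neumannVariation`). The
proof works with this form, which is free of coordinates.

All multiples are admissible. The pairing respects the tetrahedron conditions. The only abstract
edges above the new edge are the three copies of 13 in the new tetrahedra (`IsAxis.edgeOf_eq_iff`),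
so the variation lives there. An edge of the triangle 024 lies in just one of these tetrahedra,
opposite to 13, and gets 0. An edge from 1 or 3 to the triangle lies in two of them, and its two
contributions cancel because gluings reverse orientation (`IsAxis.neumannVariation_add`). Hence edge
sums do not change. Modulo 2, the variation at a selected edge counts the occurrences of `e` in the
entering and departing faces, and each face crossed by a curve is counted twice.

There is nothing else. Since the triangle edge opposite to 13 belongs to a single new tetrahedron,
its charge is determined, hence so is that of 13 there. The remaining freedom in each tetrahedron is
an integer multiple of the pairing with 13, and the edges shared by two tetrahedra force the three
multiples to agree (`IsAxis.exists_eq_add`). -/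

/-! ### The pairing on the edges of one tetrahedron -/

/-- The antisymmetric pairing of the edges of a tetrahedron, which is `0` on equal or opposite
edges and `±1` on the other pairs. -/
def edgePairing (s s' : TetEdge) : ℤ :=
  coeffOne s * coeffTwo s' - coeffTwo s * coeffOne s'

/-- The image of an edge under a permutation of the vertices. -/
def TetEdge.perm (σ : Equiv.Perm (Fin 4)) (s : TetEdge) : TetEdge :=
  ⟨s.1.map σ.toEmbedding, by rw [Finset.card_map]; exact s.2⟩

/-- The three pairs of opposite edges have coefficient vectors (1, 0), (0, -1), (-1, 1) with sum
zero, and the pairing is their determinant. A permutation of the vertices permutes these pairs with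
the same parity, since the kernel of the map from S₄ to S₃ is even. -/
theorem edgePairing_perm : ∀ (σ : Equiv.Perm (Fin 4)) (s s' : TetEdge),
    edgePairing (s.perm σ) (s'.perm σ) = Equiv.Perm.sign σ * edgePairing s s' := by
  decide +kernel

theorem edgePairing_of_disjoint : ∀ s s' : TetEdge, Disjoint s.1 s'.1 → edgePairing s s' = 0 := by
  decide +kernel

theorem edgePairing_compl : ∀ s s' r : TetEdge, s'.1 = s.1ᶜ →
    edgePairing s' r = edgePairing s r := by
  decide +kernel

theorem sum_face_edgePairing : ∀ (f : Fin 4) (r : TetEdge),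
    ∑ s : TetEdge with f ∉ s.1, edgePairing s r = 0 := by
  decide +kernel

/-- The edge common to both faces is counted twice, its opposite edge not at all, and the other four
edges, where the pairing is `±1`, exactly once. -/
theorem even_edgePairing_between : ∀ (f g : Fin 4) (h : f ≠ g) (r : TetEdge),
    Even (edgePairing (TetEdge.between f g h) r -
      ((if f ∉ r.1 then 1 else 0) + if g ∉ r.1 then 1 else 0)) := by
  decide +kernel

theorem edgePairing_sq_of_inter : ∀ s r : TetEdge, (s.1 ∩ r.1).card = 1 →
    edgePairing s r * edgePairing s r = 1 := by
  decide +kernel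

/-- A variation of charges on one tetrahedron that vanishes on an edge is a multiple of the
pairing with this edge. -/
theorem IsTetCharge.exists_sub_eq {c c' : TetEdge → ℤ} (hc : IsTetCharge c) (hc' : IsTetCharge c')
    {r : TetEdge} (hr : c' r = c r) : ∃ x : ℤ, ∀ s, c' s = c s + x * edgePairing s r := by
  have hface : ∀ b : TetEdge → ℤ, IsTetCharge b → b (TetEdge.mk 0 2 (by decide)) =
      1 - b (TetEdge.mk 0 1 (by decide)) - b (TetEdge.mk 1 2 (by decide)) := by
    intro b hb
    have h := hb.2 3
    rw [show (Finset.univ.filter fun s : TetEdge => (3 : Fin 4) ∉ s.1) =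
      {TetEdge.mk 0 1 (by decide), TetEdge.mk 1 2 (by decide), TetEdge.mk 0 2 (by decide)} by
        decide +kernel, Finset.sum_insert (by decide), Finset.sum_pair (by decide)] at h
    linarith
  -- A charge is an affine function of its values on `e₀` and `e₁`. The minus sign reflects `w₂ =
  -- -c(e₁)`.
  have hcoord : ∀ s, c' s - c s =
      coeffOne s * (c' (TetEdge.mk 0 1 (by decide)) - c (TetEdge.mk 0 1 (by decide))) -
      coeffTwo s * (c' (TetEdge.mk 1 2 (by decide)) - c (TetEdge.mk 1 2 (by decide))) := by
    have hcases : ∀ s : TetEdge,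
        (coeffOne s = 1 ∧ coeffTwo s = 0 ∧ (s = TetEdge.mk 0 1 (by decide) ∨
          s.1 = (TetEdge.mk 0 1 (by decide)).1ᶜ)) ∨
        (coeffOne s = 0 ∧ coeffTwo s = -1 ∧ (s = TetEdge.mk 1 2 (by decide) ∨
          s.1 = (TetEdge.mk 1 2 (by decide)).1ᶜ)) ∨
        (coeffOne s = -1 ∧ coeffTwo s = 1 ∧ (s = TetEdge.mk 0 2 (by decide) ∨
          s.1 = (TetEdge.mk 0 2 (by decide)).1ᶜ)) := by
      decide +kernel
    have hval : ∀ (b : TetEdge → ℤ), IsTetCharge b → ∀ s r : TetEdge,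
        (s = r ∨ s.1 = r.1ᶜ) → b s = b r := by
      rintro b hb s r (rfl | h)
      · rfl
      · exact hb.1 r s h
    intro s
    have h2 := hface c hc
    have h2' := hface c' hc'
    rcases hcases s with ⟨h₁, h₂, h⟩ | ⟨h₁, h₂, h⟩ | ⟨h₁, h₂, h⟩ <;>
      rw [h₁, h₂, hval c hc s _ h, hval c' hc' s _ h] <;> linarith
  have hcoeff : ∀ r, (coeffOne r = 1 ∧ coeffTwo r = 0) ∨ (coeffOne r = 0 ∧ coeffTwo r = -1) ∨
      (coeffOne r = -1 ∧ coeffTwo r = 1) := by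
    -- The coefficient vector of `r` is primitive, so vanishing at `r` leaves an integer multiple
    -- `x`, with `a = x * coeffTwo r` and `b = x * coeffOne r`.
    decide +kernel
  have h0 := hcoord r
  rw [hr, sub_self] at h0
  generalize c' (TetEdge.mk 0 1 _) - c (TetEdge.mk 0 1 _) = a at *
  generalize c' (TetEdge.mk 1 2 _) - c (TetEdge.mk 1 2 _) = b at *
  rcases hcoeff r with ⟨h₁, h₂⟩ | ⟨h₁, h₂⟩ | ⟨h₁, h₂⟩ <;> rw [h₁, h₂] at h0
  · refine ⟨b, fun s => ?_⟩
    have : a = 0 := by linarith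
    have h := hcoord s
    rw [this] at h
    rw [edgePairing, h₁, h₂]; linarith
  · refine ⟨-a, fun s => ?_⟩
    have : b = 0 := by linarith
    have h := hcoord s
    rw [this] at h
    rw [edgePairing, h₁, h₂]; linarith
  · refine ⟨a, fun s => ?_⟩
    have : b = -a := by linarith
    have h := hcoord s
    rw [this] at h
    rw [edgePairing, h₁, h₂]; linarith

/-! ### Neumann's vector as a variation of charges -/

namespace OrientedTriangulation

variable {τ : Type*} {T : OrientedTriangulation τ}

theorem edgeRel_perm (T : OrientedTriangulation τ) (t : τ) {f : Fin 4} {s : TetEdge}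
    (hf : f ∉ s.1) : T.EdgeRel (t, s) (T.adj t f, s.perm (T.perm t f)) :=
  ⟨f, hf, rfl, rfl⟩

theorem edgeOf_perm (T : OrientedTriangulation τ) (t : τ) {f : Fin 4} {s : TetEdge}
    (hf : f ∉ s.1) : T.edgeOf (T.adj t f, s.perm (T.perm t f)) = T.edgeOf (t, s) :=
  (Quot.sound (T.edgeRel_perm t hf)).symm

/-- The inverse of a gluing is again a gluing. With this, a property preserved by gluings descends
to `T.Edge`. -/
theorem EdgeRel.symm {a b : τ × TetEdge} (h : T.EdgeRel a b) : T.EdgeRel b a := by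
  obtain ⟨t, s⟩ := a
  obtain ⟨t', s'⟩ := b
  obtain ⟨f, hf, h₁, h₂⟩ := h
  dsimp only at hf h₁ h₂
  subst h₁
  refine ⟨T.perm t f f, ?_, (T.adj_adj t f).symm, ?_⟩
  · simpa [h₂] using hf
  · dsimp only
    rw [h₂, T.perm_perm, Finset.map_map]
    ext i
    simp

open Classical in
/-- Neumann's vector as a function on the edges of the abstract tetrahedra. -/
noncomputable def neumannVariation (T : OrientedTriangulation τ) (e : T.Edge)
    (a : τ × TetEdge) : ℤ :=
  T.orient a.1 * ∑ r : TetEdge with T.edgeOf (a.1, r) = e, edgePairing a.2 r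

theorem chargeVector_add_neumannVariation (T : OrientedTriangulation τ) (e : T.Edge)
    (c : τ × TetEdge → ℤ) (l : ℤ) :
    chargeVector (fun a => c a + l * T.neumannVariation e a) =
      chargeVector c + l • T.neumannVector e := by
  have h₁ : ∀ r, edgePairing (TetEdge.mk 0 1 (by decide)) r = coeffTwo r := by decide +kernel
  have h₂ : ∀ r, edgePairing (TetEdge.mk 1 2 (by decide)) r = coeffOne r := by decide +kernel
  funext x
  rcases x with t | t
  · simp [chargeVector, neumannVector, neumannVariation, occTwo, h₁]
  · simp [chargeVector, neumannVector, neumannVariation, occOne, h₂]; ring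

open Classical in
theorem isTetCharge_add_neumannVariation (T : OrientedTriangulation τ) (e : T.Edge)
    {c : τ × TetEdge → ℤ} {t : τ} (hc : IsTetCharge fun s => c (t, s)) (l : ℤ) :
    IsTetCharge fun s => c (t, s) + l * T.neumannVariation e (t, s) := by
  refine ⟨fun s s' h => ?_, fun f => ?_⟩
  · have := hc.1 s s' h
    dsimp only at this ⊢
    simp only [neumannVariation]
    rw [this]
    simp_rw [edgePairing_compl s s' _ h]
  · have := hc.2 f
    dsimp only at this
    rw [Finset.sum_add_distrib, this, ← Finset.mul_sum]
    have h : ∀ s, T.neumannVariation e (t, s) =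
        T.orient t * ∑ r : TetEdge with T.edgeOf (t, r) = e, edgePairing s r := fun _ => rfl
    simp_rw [h]
    rw [← Finset.mul_sum, Finset.sum_comm]
    simp [sum_face_edgePairing]

open Classical in
/-- The number of the edges of the face `f` of the tetrahedron `t` that are identified to `e`. -/
noncomputable def faceCount (T : OrientedTriangulation τ) (e : T.Edge) (t : τ) (f : Fin 4) : ℤ :=
  ∑ r : TetEdge with T.edgeOf (t, r) = e, if f ∉ r.1 then 1 else 0

theorem faceCount_adj (T : OrientedTriangulation τ) (e : T.Edge) (t : τ) (f : Fin 4) :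
    T.faceCount e (T.adj t f) (T.perm t f f) = T.faceCount e t f := by
  classical
  have key : ∀ t f, T.faceCount e t f =
      ∑ r : TetEdge with T.edgeOf (t, r) = e ∧ f ∉ r.1, 1 := by
    intro t f
    rw [faceCount, ← Finset.sum_filter, Finset.filter_filter]
  rw [key, key]
  symm
  refine Finset.sum_bij' (fun r _ => r.perm (T.perm t f)) (fun r _ => r.perm (T.perm t f)⁻¹)
    ?_ ?_ ?_ ?_ (fun _ _ => rfl)
  · intro r hr
    simp only [Finset.mem_filter, Finset.mem_univ, true_and] at hr ⊢
    exact ⟨(T.edgeOf_perm t hr.2).trans hr.1, by simpa [TetEdge.perm] using hr.2⟩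
  · intro r hr
    simp only [Finset.mem_filter, Finset.mem_univ, true_and] at hr ⊢
    have h := T.edgeOf_perm (T.adj t f) hr.2
    rw [T.adj_adj, T.perm_perm] at h
    refine ⟨h.trans hr.1, ?_⟩
    have := hr.2
    simp only [TetEdge.perm, Finset.mem_map_equiv]
    exact fun h => this h
  · intro r _
    apply Subtype.ext
    simp only [TetEdge.perm, Finset.map_map]
    ext i; simp
  · intro r _
    apply Subtype.ext
    simp only [TetEdge.perm, Finset.map_map]
    ext i; simp

/-- Along a curve, Neumann's variation changes the sum of the charges by an even number. -/
theorem Curve.even_charge_neumannVariation (γ : T.Curve) (e : T.Edge) :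
    Even (γ.charge (T.neumannVariation e)) := by
  classical
  have hloc : ∀ (t : τ) (f g : Fin 4) (h : f ≠ g),
      Even (T.neumannVariation e (t, TetEdge.between f g h) -
        (T.faceCount e t f + T.faceCount e t g)) := by
    intro t f g h
    have h₁ : Even ((∑ r : TetEdge with T.edgeOf (t, r) = e,
        edgePairing (TetEdge.between f g h) r) - (T.faceCount e t f + T.faceCount e t g)) := by
      rw [faceCount, faceCount, ← Finset.sum_add_distrib, ← Finset.sum_sub_distrib]
      exact Finset.even_sum _ fun r _ => even_edgePairing_between f g h r
    rw [neumannVariation]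
    dsimp only
    -- The sign `orient t` does not affect parity.
    rcases Int.units_eq_one_or (T.orient t) with ho | ho <;> rw [ho]
    · simpa using h₁
    · push_cast
      rw [Int.even_sub] at h₁ ⊢
      simpa using h₁
  have hshift : ∑ i, T.faceCount e (γ.tet i) (γ.enter i) =
      ∑ i, T.faceCount e (γ.tet i) (γ.leave i) := by
    -- The face by which the curve leaves one tetrahedron is the face by which it enters the next,
    -- so a cyclic shift matches the two sums.
    rw [← Equiv.sum_comp (Equiv.addRight 1) fun i => T.faceCount e (γ.tet i) (γ.enter i)]
    refine Finset.sum_congr rfl fun i _ => ?_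
    rw [Equiv.coe_addRight, ← γ.adj_leave i, ← γ.perm_leave i, faceCount_adj]
  have h : Even (∑ i, (T.neumannVariation e
        (γ.tet i, TetEdge.between (γ.enter i) (γ.leave i) (γ.enter_ne_leave i)) -
      (T.faceCount e (γ.tet i) (γ.enter i) + T.faceCount e (γ.tet i) (γ.leave i)))) :=
    Finset.even_sum _ fun i _ => hloc _ _ _ (γ.enter_ne_leave i)
  rw [Finset.sum_sub_distrib, Finset.sum_add_distrib, hshift] at h
  exact (Int.even_sub.1 h).2 (Even.add_self _)

end OrientedTriangulation

/-! ### Edges of a filling and edges of the polyhedron -/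

namespace Filling

variable {τ : Type*} {T : OrientedTriangulation τ} {K : Finset (Fin 5)} (F : Filling T K)

theorem range_vert (k : K) : Set.range (F.vert k) = {k.1}ᶜ := by
  have h : Finset.univ.map (F.vert k) = {k.1}ᶜ := by
    apply Finset.eq_of_subset_of_card_le
    · intro x hx
      obtain ⟨i, -, rfl⟩ := Finset.mem_map.1 hx
      simpa using F.vert_ne k i
    · simp [Finset.card_compl]
  simpa using congrArg (fun s : Finset (Fin 5) => (s : Set (Fin 5))) h

theorem exists_vert_eq (k : K) {x : Fin 5} (hx : x ≠ k) : ∃ i, F.vert k i = x := by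
  have h : x ∈ Set.range (F.vert k) := by rw [F.range_vert]; exact hx
  exact h

theorem notMem_map (k : K) (s : Finset (Fin 4)) : k.1 ∉ s.map (F.vert k) := by
  intro h
  obtain ⟨i, -, hi⟩ := Finset.mem_map.1 h
  exact F.vert_ne k i hi

theorem eq_of_map_eq (k : K) {s s' : TetEdge} (h : s.1.map (F.vert k) = s'.1.map (F.vert k)) :
    s = s' :=
  Subtype.ext (Finset.map_injective _ h)

theorem exists_map_eq (k : K) {E : Finset (Fin 5)} (hE : E.card = 2) (hk : k.1 ∉ E) :
    ∃ s : TetEdge, s.1.map (F.vert k) = E := by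
  have h : (Finset.univ.filter fun i => F.vert k i ∈ E).map (F.vert k) = E := by
    ext x
    simp only [Finset.mem_map, Finset.mem_filter, Finset.mem_univ, true_and]
    constructor
    · rintro ⟨i, hi, rfl⟩
      exact hi
    · intro hx
      obtain ⟨i, rfl⟩ := F.exists_vert_eq k (x := x) (by rintro rfl; exact hk hx)
      exact ⟨i, hx, rfl⟩
  exact ⟨⟨Finset.univ.filter fun i => F.vert k i ∈ E, by
    rw [← Finset.card_map (F.vert k), h, hE]⟩, h⟩

theorem map_perm {k l : K} {f : Fin 4} (hf : F.vert k f = l) {s : TetEdge} (hs : f ∉ s.1) :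
    (s.perm (T.perm (F.tet k) f)).1.map (F.vert l) = s.1.map (F.vert k) := by
  simp only [TetEdge.perm, Finset.map_map]
  apply Finset.coe_injective
  simp only [Finset.coe_map]
  refine Set.image_congr fun i hi => ?_
  exact F.perm_eq k l f hf i fun h => hs (h ▸ hi)

/-- Edges of two tetrahedra of a filling that are the same edge of the polyhedron are matched by
the gluing of the common face. -/
theorem exists_perm_eq {k l : K} (hkl : k ≠ l) {s s' : TetEdge}
    (h : s.1.map (F.vert k) = s'.1.map (F.vert l)) :
    ∃ f, F.vert k f = l ∧ f ∉ s.1 ∧ s' = s.perm (T.perm (F.tet k) f) := by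
  obtain ⟨f, hf⟩ := F.exists_vert_eq k (x := l) fun h => hkl (Subtype.ext h.symm)
  have hs : f ∉ s.1 := by
    intro hs
    refine F.notMem_map l s'.1 (h ▸ ?_)
    exact hf ▸ Finset.mem_map_of_mem _ hs
  exact ⟨f, hf, hs, F.eq_of_map_eq l (by rw [F.map_perm hf hs, h])⟩

theorem edgeOf_eq_of_map_eq {k l : K} {s s' : TetEdge}
    (h : s.1.map (F.vert k) = s'.1.map (F.vert l)) :
    T.edgeOf (F.tet k, s) = T.edgeOf (F.tet l, s') := by
  rcases eq_or_ne k l with rfl | hkl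
  · rw [F.eq_of_map_eq k h]
  · obtain ⟨f, hf, hs, rfl⟩ := F.exists_perm_eq hkl h
    rw [← F.adj_eq k l f hf, T.edgeOf_perm _ hs]

/-- The sum of the charges of the tetrahedron `Δᵏ` on the edge `E` of the polyhedron. -/
def tetSum (c : τ × TetEdge → ℤ) (k : K) (E : Finset (Fin 5)) : ℤ :=
  ∑ s : TetEdge with s.1.map (F.vert k) = E, c (F.tet k, s)

theorem localSum_eq_sum_tetSum (c : τ × TetEdge → ℤ) (E : Finset (Fin 5)) :
    F.localSum c E = ∑ k : K, F.tetSum c k E := rfl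

theorem tetSum_of_map_eq (c : τ × TetEdge → ℤ) {k : K} {E : Finset (Fin 5)} {s : TetEdge}
    (h : s.1.map (F.vert k) = E) : F.tetSum c k E = c (F.tet k, s) := by
  have : (Finset.univ.filter fun s : TetEdge => s.1.map (F.vert k) = E) = {s} := by
    ext s'
    simp only [Finset.mem_filter, Finset.mem_univ, true_and, Finset.mem_singleton]
    exact ⟨fun h' => F.eq_of_map_eq k (h'.trans h.symm), fun h' => h' ▸ h⟩
  rw [tetSum, this, Finset.sum_singleton]

theorem tetSum_of_mem (c : τ × TetEdge → ℤ) {k : K} {E : Finset (Fin 5)} (h : k.1 ∈ E) :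
    F.tetSum c k E = 0 := by
  refine Finset.sum_eq_zero fun s hs => ?_
  rw [Finset.mem_filter] at hs
  exact absurd (hs.2 ▸ h) (F.notMem_map k s.1)

theorem localSum_add_mul (c d : τ × TetEdge → ℤ) (l : ℤ) (E : Finset (Fin 5)) :
    F.localSum (fun a => c a + l * d a) E = F.localSum c E + l * F.localSum d E := by
  simp only [localSum, Finset.sum_add_distrib, Finset.mul_sum]

end Filling

/-! ### Neumann's variation around the axis 13 -/

namespace Filling

variable {τ : Type*} {T : OrientedTriangulation τ} (F : Filling T {0, 2, 4})

theorem sum_eq (g : ({0, 2, 4} : Finset (Fin 5)) → ℤ) :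
    ∑ k, g k = g ⟨0, by decide⟩ + g ⟨2, by decide⟩ + g ⟨4, by decide⟩ := by
  rw [show (Finset.univ : Finset ({0, 2, 4} : Finset (Fin 5))) =
    {⟨0, by decide⟩, ⟨2, by decide⟩, ⟨4, by decide⟩} by decide,
    Finset.sum_insert (by decide), Finset.sum_pair (by decide), add_assoc]

/-- `e` is the edge of the triangulation around which the three tetrahedra are arranged. -/
def IsAxis (e : T.Edge) : Prop :=
  ∃ (k : ({0, 2, 4} : Finset (Fin 5))) (s : TetEdge),
    s.1.map (F.vert k) = {1, 3} ∧ T.edgeOf (F.tet k, s) = e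

theorem notMem_axis (k : ({0, 2, 4} : Finset (Fin 5))) : k.1 ∉ ({1, 3} : Finset (Fin 5)) := by
  revert k; decide

/-- `a` is the edge joining the vertices 1 and 3 of one of the three tetrahedra. -/
def IsAxial (a : τ × TetEdge) : Prop :=
  ∃ k, a.1 = F.tet k ∧ a.2.1.map (F.vert k) = {1, 3}

variable {F}

/-- A face of `Δᵏ` that contains 13 is opposite to a vertex among 0, 2, 4, so it is glued to another
tetrahedron of the filling. -/
theorem IsAxial.of_edgeRel {a b : τ × TetEdge} (h : T.EdgeRel a b) (ha : F.IsAxial a) :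
    F.IsAxial b := by
  obtain ⟨t, s⟩ := a
  obtain ⟨t', s'⟩ := b
  obtain ⟨k, hk, hs⟩ := ha
  obtain ⟨f, hf, h₁, h₂⟩ := h
  dsimp only at hk hs hf h₁ h₂
  subst hk h₁
  have hl : F.vert k f ∈ ({0, 2, 4} : Finset (Fin 5)) := by
    have h : F.vert k f ∉ ({1, 3} : Finset (Fin 5)) := by
      rw [← hs]
      simpa using hf
    revert h
    generalize F.vert k f = x
    revert x
    decide
  refine ⟨⟨F.vert k f, hl⟩, F.adj_eq k ⟨_, hl⟩ f rfl, ?_⟩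
  have h := F.map_perm (l := ⟨_, hl⟩) rfl hf
  dsimp only
  rw [h₂]
  exact h.trans hs

theorem IsAxis.edgeOf_eq_iff {e : T.Edge} (he : F.IsAxis e) (a : τ × TetEdge) :
    T.edgeOf a = e ↔ F.IsAxial a := by
  obtain ⟨k, s, hs, rfl⟩ := he
  constructor
  · intro h
    let P : T.Edge → Prop := Quot.lift F.IsAxial fun a b h =>
      propext ⟨fun ha => ha.of_edgeRel h, fun hb => hb.of_edgeRel h.symm⟩
    have hP : P (T.edgeOf (F.tet k, s)) := ⟨k, rfl, hs⟩
    rw [← h] at hP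
    exact hP
  · obtain ⟨t, s'⟩ := a
    rintro ⟨l, h, hs'⟩
    dsimp only at h hs'
    subst h
    exact F.edgeOf_eq_of_map_eq (hs'.trans hs.symm)

theorem IsAxis.not_edgeOf_eq {e : T.Edge} (he : F.IsAxis e) {t : τ}
    (ht : t ∉ Set.range F.tet) (s : TetEdge) : T.edgeOf (t, s) ≠ e := by
  rw [Ne, he.edgeOf_eq_iff]
  rintro ⟨k, hk, -⟩
  exact ht ⟨k, hk.symm⟩

theorem IsAxis.edgeOf_tet_eq_iff {e : T.Edge} (he : F.IsAxis e)
    {k : ({0, 2, 4} : Finset (Fin 5))} {r : TetEdge} (hr : r.1.map (F.vert k) = {1, 3})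
    (s : TetEdge) : T.edgeOf (F.tet k, s) = e ↔ s = r := by
  rw [he.edgeOf_eq_iff]
  constructor
  · rintro ⟨l, hl, hs⟩
    obtain rfl := F.tet_injective hl
    exact F.eq_of_map_eq _ (hs.trans hr.symm)
  · rintro rfl
    exact ⟨k, rfl, hr⟩

theorem IsAxis.neumannVariation_of_notMem {e : T.Edge} (he : F.IsAxis e) {t : τ}
    (ht : t ∉ Set.range F.tet) (s : TetEdge) : T.neumannVariation e (t, s) = 0 := by
  classical
  simp [OrientedTriangulation.neumannVariation, he.not_edgeOf_eq ht]

theorem IsAxis.neumannVariation_tet {e : T.Edge} (he : F.IsAxis e)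
    {k : ({0, 2, 4} : Finset (Fin 5))} {r : TetEdge} (hr : r.1.map (F.vert k) = {1, 3})
    (s : TetEdge) :
    T.neumannVariation e (F.tet k, s) = T.orient (F.tet k) * edgePairing s r := by
  classical
  simp only [OrientedTriangulation.neumannVariation, he.edgeOf_tet_eq_iff hr]
  rw [Finset.sum_filter, Finset.sum_ite_eq' Finset.univ r, if_pos (Finset.mem_univ r)]

/-- The variations cancel on an edge of the common face of two tetrahedra. -/
theorem IsAxis.neumannVariation_add {e : T.Edge} (he : F.IsAxis e)
    {k l : ({0, 2, 4} : Finset (Fin 5))} (hkl : k ≠ l) {s s' : TetEdge}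
    (h : s.1.map (F.vert k) = s'.1.map (F.vert l)) :
    T.neumannVariation e (F.tet k, s) + T.neumannVariation e (F.tet l, s') = 0 := by
  obtain ⟨r, hr⟩ := F.exists_map_eq k (E := {1, 3}) rfl (notMem_axis k)
  obtain ⟨r', hr'⟩ := F.exists_map_eq l (E := {1, 3}) rfl (notMem_axis l)
  rw [he.neumannVariation_tet hr, he.neumannVariation_tet hr']
  obtain ⟨f, hf, hs, rfl⟩ := F.exists_perm_eq hkl h
  obtain ⟨f', hf', hs', rfl⟩ := F.exists_perm_eq hkl (hr.trans hr'.symm)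
  -- One gluing carries both the edge and the axis. It multiplies the pairing by its sign and the
  -- orientation by minus its sign.
  obtain rfl := (F.vert k).injective (hf.trans hf'.symm)
  rw [edgePairing_perm, ← F.adj_eq k l f hf, T.orient_adj]
  rcases Int.units_eq_one_or (Equiv.Perm.sign (T.perm (F.tet k) f)) with h₁ | h₁ <;>
    rw [h₁] <;> simp

theorem IsAxis.tetSum_neumannVariation_add {e : T.Edge} (he : F.IsAxis e)
    {k l : ({0, 2, 4} : Finset (Fin 5))} (hkl : k ≠ l) {E : Finset (Fin 5)} (hE : E.card = 2)
    (hk : k.1 ∉ E) (hl : l.1 ∉ E) :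
    F.tetSum (T.neumannVariation e) k E + F.tetSum (T.neumannVariation e) l E = 0 := by
  obtain ⟨s, hs⟩ := F.exists_map_eq k hE hk
  obtain ⟨s', hs'⟩ := F.exists_map_eq l hE hl
  rw [F.tetSum_of_map_eq _ hs, F.tetSum_of_map_eq _ hs',
    he.neumannVariation_add hkl (hs.trans hs'.symm)]

theorem IsAxis.tetSum_neumannVariation_of_disjoint {e : T.Edge} (he : F.IsAxis e)
    (k : ({0, 2, 4} : Finset (Fin 5))) {E : Finset (Fin 5)} (hE : Disjoint E {1, 3}) :
    F.tetSum (T.neumannVariation e) k E = 0 := by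
  obtain ⟨r, hr⟩ := F.exists_map_eq k (E := {1, 3}) rfl (notMem_axis k)
  refine Finset.sum_eq_zero fun s hs => ?_
  rw [Finset.mem_filter] at hs
  rw [he.neumannVariation_tet hr, edgePairing_of_disjoint, mul_zero]
  rwa [← hs.2, ← hr, Finset.disjoint_map] at hE

theorem disjoint_axis : ∀ E : Finset (Fin 5), E.card = 2 →
    (0 ∈ E ∧ 2 ∈ E ∨ 0 ∈ E ∧ 4 ∈ E ∨ 2 ∈ E ∧ 4 ∈ E) → Disjoint E {1, 3} := by
  decide +kernel

theorem IsAxis.localSum_neumannVariation {e : T.Edge} (he : F.IsAxis e) {E : Finset (Fin 5)}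
    (hE : E.card = 2) : F.localSum (T.neumannVariation e) E = 0 := by
  rw [localSum_eq_sum_tetSum]
  by_cases hd : Disjoint E {1, 3}
  · exact Finset.sum_eq_zero fun k _ => he.tetSum_neumannVariation_of_disjoint k hd
  have h := mt (disjoint_axis E hE) hd
  rw [sum_eq]
  have h02 := he.tetSum_neumannVariation_add (k := ⟨0, by decide⟩) (l := ⟨2, by decide⟩)
    (by decide) hE
  have h04 := he.tetSum_neumannVariation_add (k := ⟨0, by decide⟩) (l := ⟨4, by decide⟩)
    (by decide) hE
  have h24 := he.tetSum_neumannVariation_add (k := ⟨2, by decide⟩) (l := ⟨4, by decide⟩)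
    (by decide) hE
  have h0 := F.tetSum_of_mem (T.neumannVariation e) (k := ⟨0, by decide⟩) (E := E)
  have h2 := F.tetSum_of_mem (T.neumannVariation e) (k := ⟨2, by decide⟩) (E := E)
  have h4 := F.tetSum_of_mem (T.neumannVariation e) (k := ⟨4, by decide⟩) (E := E)
  dsimp only at h02 h04 h24 h0 h2 h4
  -- By `h`, at most one of 0, 2, 4 lies in `E`. If one does, the other two tetrahedra cancel; if
  -- none does, the three pairwise relations add up to twice the sum.
  by_cases m0 : (0 : Fin 5) ∈ E <;> by_cases m2 : (2 : Fin 5) ∈ E <;>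
    by_cases m4 : (4 : Fin 5) ∈ E <;> simp_all <;> linarith

theorem IsAxis.edgeSum_neumannVariation [Fintype τ] {e : T.Edge} (he : F.IsAxis e)
    (e' : T.Edge) : T.edgeSum (T.neumannVariation e) e' = 0 := by
  classical
  have h₁ : T.edgeSum (T.neumannVariation e) e' =
      ∑ t, ∑ s, if T.edgeOf (t, s) = e' then T.neumannVariation e (t, s) else 0 := by
    rw [OrientedTriangulation.edgeSum, Finset.sum_filter, Fintype.sum_prod_type]
  have h₂ : ∑ t, ∑ s, (if T.edgeOf (t, s) = e' then T.neumannVariation e (t, s) else 0) =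
      ∑ k, ∑ s, if T.edgeOf (F.tet k, s) = e' then T.neumannVariation e (F.tet k, s) else 0 := by
    refine (Fintype.sum_of_injective F.tet F.tet_injective _ _ (fun t ht => ?_) fun _ => rfl).symm
    exact Finset.sum_eq_zero fun s _ => by rw [he.neumannVariation_of_notMem ht, ite_self]
  have h₃ : ∀ k, (∑ s, if T.edgeOf (F.tet k, s) = e' then T.neumannVariation e (F.tet k, s)
      else 0) = ∑ E : Finset (Fin 5), ∑ s : TetEdge with s.1.map (F.vert k) = E,
        if T.edgeOf (F.tet k, s) = e' then T.neumannVariation e (F.tet k, s) else 0 := by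
    intro k
    exact (Finset.sum_fiberwise _ _ _).symm
  rw [h₁, h₂, Finset.sum_congr rfl fun k _ => h₃ k, Finset.sum_comm]
  refine Finset.sum_eq_zero fun E _ => ?_
  -- The copies of one edge `E` of the polyhedron lie either all above `e'` or all off it, so each
  -- group contributes a full local sum or nothing.
  by_cases hE : ∃ k s, s.1.map (F.vert k) = E ∧ T.edgeOf (F.tet k, s) = e'
  · obtain ⟨k, s, hs, hs'⟩ := hE
    rw [← he.localSum_neumannVariation (E := E) (by rw [← hs, Finset.card_map, s.2])]
    refine Finset.sum_congr rfl fun l _ => Finset.sum_congr rfl fun r hr => if_pos ?_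
    rw [Finset.mem_filter] at hr
    rw [← hs']
    exact F.edgeOf_eq_of_map_eq (hr.2.trans hs.symm)
  · refine Finset.sum_eq_zero fun l _ => Finset.sum_eq_zero fun r hr => if_neg fun h => ?_
    rw [Finset.mem_filter] at hr
    exact hE ⟨l, r, hr.2, h⟩

end Filling
-- Rigidity: the variations form a single line
namespace Filling

variable {τ : Type*} {T : OrientedTriangulation τ} {F : Filling T {0, 2, 4}}

/-- Two charges of the three tetrahedra with the same sums at the nine edges of the bipyramid
differ by a multiple of Neumann's variation. -/
theorem IsAxis.exists_eq_add {e : T.Edge} (he : F.IsAxis e) {c c' : τ × TetEdge → ℤ}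
    (hc : ∀ t, IsTetCharge fun s => c (t, s)) (hc' : ∀ t, IsTetCharge fun s => c' (t, s))
    (h : ∀ E : Finset (Fin 5), E.card = 2 → E ≠ {1, 3} → F.localSum c' E = F.localSum c E) :
    ∃ l : ℤ, ∀ k s, c' (F.tet k, s) = c (F.tet k, s) + l * T.neumannVariation e (F.tet k, s) := by
  have hlocal : ∀ k, ∃ y : ℤ, ∀ s,
      c' (F.tet k, s) = c (F.tet k, s) + y * T.neumannVariation e (F.tet k, s) := by
    intro k
    obtain ⟨r, hr⟩ := F.exists_map_eq k (E := {1, 3}) rfl (notMem_axis k)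
    -- `E` is the triangle edge opposite to the axis in `Δᵏ`; no other tetrahedron of the filling
    -- contains it.
    have hE : ∀ k : ({0, 2, 4} : Finset (Fin 5)), ∃ E : Finset (Fin 5),
        E.card = 2 ∧ E ≠ {1, 3} ∧ Disjoint E {1, 3} ∧ k.1 ∉ E ∧
          ∀ l : ({0, 2, 4} : Finset (Fin 5)), l ≠ k → l.1 ∈ E := by
      decide +kernel
    obtain ⟨E, hE, hE', hd, hk, hl⟩ := hE k
    obtain ⟨r', hr'⟩ := F.exists_map_eq k hE hk
    have hsum : ∀ b, F.localSum b E = b (F.tet k, r') := by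
      intro b
      rw [localSum_eq_sum_tetSum, Fintype.sum_eq_single k fun l hlk => F.tetSum_of_mem b (hl l hlk),
        F.tetSum_of_map_eq b hr']
    have hcompl : ∀ r r' : TetEdge, Disjoint r'.1 r.1 → r'.1 = r.1ᶜ := by decide +kernel
    have hrr' : r'.1 = r.1ᶜ := by
      apply hcompl
      rwa [← hr, ← hr', Finset.disjoint_map] at hd
    have heq := h E hE hE'
    rw [hsum, hsum] at heq
    have h₁ := (hc (F.tet k)).1 r r' hrr'
    have h₂ := (hc' (F.tet k)).1 r r' hrr'
    dsimp only at h₁ h₂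
    obtain ⟨x, hx⟩ := (hc (F.tet k)).exists_sub_eq (hc' (F.tet k)) (r := r)
      (h₂.symm.trans (heq.trans h₁))
    -- The sign squares to 1 and cancels the one in `neumannVariation`.
    refine ⟨T.orient (F.tet k) * x, fun s => ?_⟩
    rw [hx, he.neumannVariation_tet hr]
    rcases Int.units_eq_one_or (T.orient (F.tet k)) with ho | ho <;> rw [ho] <;> simp
  choose y hy using hlocal
  have hconst : ∀ k l, k ≠ l → y k = y l := by
    intro k l hkl
    -- `E` joins 1 or 3 to the third vertex of the triangle, so it is shared by exactly `Δᵏ` and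
    -- `Δˡ`, and the variation there is `±1`.
    have hE : ∀ k l : ({0, 2, 4} : Finset (Fin 5)), k ≠ l → ∃ E : Finset (Fin 5),
        E.card = 2 ∧ E ≠ {1, 3} ∧ (E ∩ {1, 3}).card = 1 ∧ k.1 ∉ E ∧ l.1 ∉ E ∧
          ∀ j : ({0, 2, 4} : Finset (Fin 5)), j ≠ k ∧ j ≠ l → j.1 ∈ E := by
      decide +kernel
    obtain ⟨E, hE, hE', hi, hk, hl, hj⟩ := hE k l hkl
    obtain ⟨r, hr⟩ := F.exists_map_eq k (E := {1, 3}) rfl (notMem_axis k)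
    obtain ⟨s, hs⟩ := F.exists_map_eq k hE hk
    obtain ⟨s', hs'⟩ := F.exists_map_eq l hE hl
    have hsum : ∀ b, F.localSum b E = b (F.tet k, s) + b (F.tet l, s') := by
      intro b
      rw [localSum_eq_sum_tetSum, Fintype.sum_eq_add k l hkl fun j hjkl =>
        F.tetSum_of_mem b (hj j hjkl), F.tetSum_of_map_eq b hs, F.tetSum_of_map_eq b hs']
    have heq := h E hE hE'
    rw [hsum, hsum, hy, hy] at heq
    have hadd := he.neumannVariation_add hkl (hs.trans hs'.symm)
    have hsq : T.neumannVariation e (F.tet k, s) * T.neumannVariation e (F.tet k, s) = 1 := by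
      have h₁ : (s.1 ∩ r.1).card = 1 := by
        rwa [← hs, ← hr, ← Finset.map_inter, Finset.card_map] at hi
      rw [he.neumannVariation_tet hr, mul_mul_mul_comm, edgePairing_sq_of_inter s r h₁, mul_one]
      rcases Int.units_eq_one_or (T.orient (F.tet k)) with ho | ho <;> rw [ho] <;> simp
    have hne : T.neumannVariation e (F.tet k, s) ≠ 0 := by
      intro h0
      rw [h0] at hsq
      simp at hsq
    rw [eq_neg_of_add_eq_zero_right hadd] at heq
    exact mul_right_cancel₀ hne (by linarith)
  refine ⟨y ⟨0, by decide⟩, fun k s => ?_⟩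
  rw [hy k s]
  rcases eq_or_ne k ⟨0, by decide⟩ with rfl | hk
  · rfl
  · rw [hconst k _ hk]

theorem IsAxis.occ_tet {e : T.Edge} (he : F.IsAxis e)
    {k : ({0, 2, 4} : Finset (Fin 5))} {r : TetEdge} (hr : r.1.map (F.vert k) = {1, 3}) :
    T.occOne e (F.tet k) = coeffOne r ∧ T.occTwo e (F.tet k) = coeffTwo r := by
  classical
  simp only [OrientedTriangulation.occOne, OrientedTriangulation.occTwo, he.edgeOf_tet_eq_iff hr]
  constructor <;>
    rw [Finset.sum_filter, Finset.sum_ite_eq' Finset.univ r, if_pos (Finset.mem_univ r)]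

/-- A strictly monotone map on `Fin 4` is determined by its range, here the complement of `k`. -/
theorem vert_eq_succAboveEmb {K : Finset (Fin 5)} {G : Filling T K} {k : K}
    (hk : StrictMono (G.vert k)) : G.vert k = Fin.succAboveEmb k.1 := by
  apply DFunLike.coe_injective
  rw [Fin.coe_succAboveEmb, ← hk.range_inj (Fin.strictMono_succAbove k.1), G.range_vert,
    Fin.range_succAbove]

end Filling

/-! ### Integral charges and transits -/

namespace OrientedTriangulation

variable {τ : Type*} [Fintype τ] {T : OrientedTriangulation τ}

theorem IsIntegralCharge.add_neumannVariation {H : Set T.Edge} {c : τ × TetEdge → ℤ}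
    (hc : T.IsIntegralCharge H c) {F : Filling T {0, 2, 4}} {e : T.Edge} (he : F.IsAxis e)
    (l : ℤ) : T.IsIntegralCharge H fun a => c a + l * T.neumannVariation e a := by
  classical
  have hsum : ∀ e', T.edgeSum (fun a => c a + l * T.neumannVariation e a) e' =
      T.edgeSum c e' := by
    intro e'
    have h := he.edgeSum_neumannVariation e'
    unfold edgeSum at h ⊢
    rw [Finset.sum_add_distrib, ← Finset.mul_sum, h, mul_zero, add_zero]
  refine ⟨fun t => T.isTetCharge_add_neumannVariation e (hc.tet t) l,
    fun e' h => (hsum e').trans (hc.edge_notMem e' h),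
    fun e' h => (hsum e').trans (hc.edge_mem e' h), fun γ => ?_⟩
  have h : γ.charge (fun a => c a + l * T.neumannVariation e a) =
      γ.charge c + l * γ.charge (T.neumannVariation e) := by
    simp only [Curve.charge, Finset.sum_add_distrib, Finset.mul_sum]
  rw [h]
  exact (hc.curve γ).add ((γ.even_charge_neumannVariation e).mul_left l)

end OrientedTriangulation

namespace TwoThreeMove

variable {τ₁ τ₂ : Type*} {T₁ : OrientedTriangulation τ₁} {T₂ : OrientedTriangulation τ₂}
  {m : TwoThreeMove T₁ T₂} {c₁ : τ₁ × TetEdge → ℤ} {c₂ c₂' : τ₂ × TetEdge → ℤ} {e : T₂.Edge}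

theorem IsChargeTransit.add_neumannVariation (h : m.IsChargeTransit c₁ c₂) (he : m.IsNewEdge e)
    (l : ℤ) : m.IsChargeTransit c₁ fun a => c₂ a + l * T₂.neumannVariation e a := by
  have he' : m.new.IsAxis e := he
  refine ⟨fun t s => ?_, fun E hE hE' => ?_⟩
  · rw [he'.neumannVariation_of_notMem (m.rest t).2, mul_zero, add_zero, h.outside]
  · rw [m.new.localSum_add_mul, he'.localSum_neumannVariation hE, mul_zero, add_zero,
      h.inside E hE hE']

theorem IsChargeTransit.exists_eq_add (h : m.IsChargeTransit c₁ c₂)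
    (h' : m.IsChargeTransit c₁ c₂') (he : m.IsNewEdge e)
    (hc : ∀ t, IsTetCharge fun s => c₂ (t, s)) (hc' : ∀ t, IsTetCharge fun s => c₂' (t, s)) :
    ∃ l : ℤ, c₂' = fun a => c₂ a + l * T₂.neumannVariation e a := by
  have he' : m.new.IsAxis e := he
  obtain ⟨l, hl⟩ := he'.exists_eq_add hc hc' fun E hE hE' =>
    (h'.inside E hE hE').symm.trans (h.inside E hE hE')
  refine ⟨l, funext fun ⟨t, s⟩ => ?_⟩
  by_cases ht : t ∈ Set.range m.new.tet
  · obtain ⟨k, rfl⟩ := ht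
    exact hl k s
  · rw [he'.neumannVariation_of_notMem ht, mul_zero, add_zero]
    have h₁ := h.outside (m.rest.symm ⟨t, ht⟩) s
    have h₂ := h'.outside (m.rest.symm ⟨t, ht⟩) s
    rw [Equiv.apply_symm_apply] at h₁ h₂
    exact h₂.trans h₁.symm

end TwoThreeMove

theorem mainTheorem11 {W : Type*} [TopologicalSpace W] [T2Space W] [CompactSpace W]
    [ChartedSpace (EuclideanSpace ℝ (Fin 3)) W] (L : Set W) (hL : IsLink L)
    {τ₁ τ₂ : Type*} [Fintype τ₁] [Fintype τ₂]
    (T₁ : OrientedTriangulation τ₁) (T₂ : OrientedTriangulation τ₂)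
    (H₁ : Set T₁.Edge) (H₂ : Set T₂.Edge)
    (hT₁ : T₁.IsDistinguished H₁ W L) (hT₂ : T₂.IsDistinguished H₂ W L)
    (m : TwoThreeMove T₁ T₂) (hm : m.IsDistinguishedMove H₁ H₂)
    (e : T₂.Edge) (he : m.IsNewEdge e)
    (c₁ : τ₁ × TetEdge → ℤ) (hc₁ : T₁.IsIntegralCharge H₁ c₁)
    (c₂ : τ₂ × TetEdge → ℤ) (hc₂ : T₂.IsIntegralCharge H₂ c₂)
    (hc₁₂ : m.IsChargeTransit c₁ c₂) :
    chargeVector '' {c₂' | T₂.IsIntegralCharge H₂ c₂' ∧ m.IsChargeTransit c₁ c₂'} =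
      {v | ∃ l : ℤ, v = chargeVector c₂ + l • T₂.neumannVector e} ∧
    (∀ t, t ∉ Set.range m.new.tet →
      T₂.neumannVector e (Sum.inl t) = 0 ∧ T₂.neumannVector e (Sum.inr t) = 0) ∧
    ((∀ k, StrictMono (m.new.vert k) ∧ T₂.orient (m.new.tet k) = 1) →
      ∀ k, T₂.neumannVector e (Sum.inl (m.new.tet k)) = (if k.1 = 2 then -1 else 1) ∧
        T₂.neumannVector e (Sum.inr (m.new.tet k)) = (if k.1 = 2 then 0 else 1)) := by
  -- `IsNewEdge` unfolds to `IsAxis` for the new filling.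
  have he' : m.new.IsAxis e := he
  refine ⟨?_, fun t ht => ?_, fun hord k => ?_⟩
  · ext v
    constructor
    · rintro ⟨c₂', ⟨hc, ht⟩, rfl⟩
      obtain ⟨l, rfl⟩ := hc₁₂.exists_eq_add ht he hc₂.tet hc.tet
      exact ⟨l, T₂.chargeVector_add_neumannVariation e c₂ l⟩
    · rintro ⟨l, rfl⟩
      exact ⟨_, ⟨hc₂.add_neumannVariation he' l, hc₁₂.add_neumannVariation he l⟩,
        T₂.chargeVector_add_neumannVariation e c₂ l⟩
  · classical
    simp [OrientedTriangulation.neumannVector, OrientedTriangulation.occOne,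
      OrientedTriangulation.occTwo, he'.not_edgeOf_eq ht]
  · obtain ⟨r, hr⟩ := m.new.exists_map_eq k (E := {1, 3}) rfl (Filling.notMem_axis k)
    obtain ⟨h₁, h₂⟩ := he'.occ_tet hr
    rw [Filling.vert_eq_succAboveEmb (hord k).1] at hr
    -- In increasing order the axis 13 is `[v₀, v₂]` in `Δ⁰`, `[v₁, v₂]` in `Δ²`, and `[v₁, v₃]`,
    -- opposite to `[v₀, v₂]`, in `Δ⁴`.
    have hcoeff : ∀ (k : ({0, 2, 4} : Finset (Fin 5))) (r : TetEdge),
        r.1.map (Fin.succAboveEmb k.1) = {1, 3} →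
        coeffTwo r = (if k.1 = 2 then -1 else 1) ∧ -coeffOne r = (if k.1 = 2 then 0 else 1) := by
      decide +kernel
    simpa [OrientedTriangulation.neumannVector, h₁, h₂, (hord k).2] using hcoeff k r hr
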